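/- Let $q$ be a prime power, let $\mathbb{F}_q$ be the field with $q$ elements, and let $m \ge 1$ be an integer. Let $R_q(1,m)$ be the first-order generalized Reed–Muller code, i.e. the set of all functions $\mathbb{F}_q^m \to \mathbb{F}_q$ whose polynomial representative of degree at most $q-1$ in each variable has total degree at most $1$; it is a code of length $q^m$ over $\mathbb{F}_q$. Let $$\rho(1,m) = \max_{f:\mathbb{F}_q^m\to\mathbb{F}_q}\ \min_{c\in R_q(1,m)} \#\{x\in\mathbb{F}_q^m : f(x)\ne c(x)\}$$ be its covering radius. Then $$(q-1)q^{m-1}-q^{\lceil m/2\rceil-1}\ \le\ \rho(1,m)\ \le\ (q-1)q^{m-1}-q^{m/2-1}.$$ -/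

import Mathlib

/-- The distance from the word `x` to the code `C`: the least Hamming distance `|x - c|`, `c ∈ C`.
(For a nonempty code this infimum in `ℕ` is a minimum.) -/
noncomputable def distToCode {ι F : Type*} [Fintype ι] [DecidableEq F]
    (C : Set (ι → F)) (x : ι → F) : ℕ :=
  sInf {d : ℕ | ∃ c ∈ C, hammingDist x c = d}

/-- The covering radius `max_x min_{c ∈ C} |x - c|` of a code `C` of length `Fintype.card ι`.
(All distances are at most the length, so this supremum in `ℕ` is a maximum.) -/
noncomputable def coveringRadius {ι F : Type*} [Fintype ι] [DecidableEq F]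
    (C : Set (ι → F)) : ℕ :=
  sSup {d : ℕ | ∃ x : ι → F, distToCode C x = d}

/-- The generalized Reed-Muller code of order `r` in `m` variables over the finite field `F` with
`q` elements: the functions `F^m → F` whose polynomial representative of degree at most `q - 1` in
each variable has total degree at most `r`. Words are indexed by the points of `F^m`. -/
def reedMuller (F : Type*) [Field F] [Fintype F] (r m : ℕ) : Set ((Fin m → F) → F) :=
  {f | ∃ P : MvPolynomial (Fin m) F, (∀ i, P.degreeOf i ≤ Fintype.card F - 1) ∧
    P.totalDegree ≤ r ∧ ∀ x, MvPolynomial.eval x P = f x}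

/-! The distance from `f` to the code is `q ^ m` minus the largest `agreement` of `f` with an affine
function, so both bounds concern how small that maximum can be. Lower bound: quadratic forms agree
little with every affine function. The cases `m = 1, 2` are handled by a square and by the norm from
the quadratic extension; adding hyperbolic planes gives every other `m`. Upper bound: a second
moment. The sum of squared agreements over all affine functions does not depend on `f`
(`sum_sum_agreement_sq`). For a fixed slope the deviations from the mean `q ^ (m - 1)` sum to zero,
so bounding them above bounds their squares, and some deviation must be large. -/

section Codes

variable {ι F : Type*} [Fintype ι] [DecidableEq F]

lemma exists_mem_hammingDist_eq_distToCode {C : Set (ι → F)} (hC : C.Nonempty) (x : ι → F) :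
    ∃ c ∈ C, hammingDist x c = distToCode C x :=
  Nat.sInf_mem (s := {d : ℕ | ∃ c ∈ C, hammingDist x c = d}) (hC.elim fun c hc => ⟨_, c, hc, rfl⟩)

lemma distToCode_le {C : Set (ι → F)} {x c : ι → F} (hc : c ∈ C) :
    distToCode C x ≤ hammingDist x c :=
  Nat.sInf_le ⟨c, hc, rfl⟩

lemma bddAbove_distToCode {C : Set (ι → F)} (hC : C.Nonempty) :
    BddAbove {d : ℕ | ∃ x : ι → F, distToCode C x = d} := by
  refine ⟨Fintype.card ι, ?_⟩
  rintro _ ⟨x, rfl⟩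
  obtain ⟨c, hc⟩ := hC
  exact (distToCode_le hc).trans hammingDist_le_card_fintype

lemma distToCode_le_coveringRadius {C : Set (ι → F)} (hC : C.Nonempty) (x : ι → F) :
    distToCode C x ≤ coveringRadius C :=
  le_csSup (bddAbove_distToCode hC) ⟨x, rfl⟩

lemma exists_distToCode_eq_coveringRadius [Nonempty F] {C : Set (ι → F)} (hC : C.Nonempty) :
    ∃ x : ι → F, distToCode C x = coveringRadius C :=
  Nat.sSup_mem (s := {d : ℕ | ∃ x : ι → F, distToCode C x = d})
    ⟨_, fun _ => Classical.arbitrary F, rfl⟩ (bddAbove_distToCode hC)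

lemma hammingDist_add_card_agree (f g : ι → F) :
    hammingDist f g + (Finset.univ.filter fun x => f x = g x).card = Fintype.card ι := by
  rw [hammingDist, add_comm, ← Finset.card_univ]
  exact Finset.card_filter_add_card_filter_not (s := Finset.univ) (fun x => f x = g x)

end Codes

/-! ### Order one codewords as affine functions; agreement counts. -/

section AffineFunctions

variable {F : Type*} [Field F] [Fintype F]

lemma MvPolynomial.eval_eq_affine_of_totalDegree_le_one {σ : Type*} [Fintype σ] {R : Type*}
    [CommSemiring R] {P : MvPolynomial σ R} (hP : P.totalDegree ≤ 1) (x : σ → R) :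
    eval x P = coeff 0 P + ∑ i, coeff (Finsupp.single i 1) P * x i := by
  classical
  have key : ∀ d ∈ P.support, d = 0 ∨ ∃ i, d = Finsupp.single i 1 := by
    intro d hd
    have h1 : d.degree ≤ 1 := by
      have := MvPolynomial.le_totalDegree hd
      rw [Finsupp.degree_eq_sum]
      rw [Finsupp.sum_fintype _ _ (by simp)] at this
      exact this.trans hP
    rcases Nat.le_one_iff_eq_zero_or_eq_one.mp h1 with h | h
    · exact Or.inl ((Finsupp.degree_eq_zero_iff d).mp h)
    · exact Or.inr (by
        rw [Finsupp.degree_eq_sum, ← Finsupp.sum_fintype d (fun _ n => n) (by simp)] at h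
        exact (Finsupp.sum_eq_one_iff d).mp h)
  let S : Finset (σ →₀ ℕ) := insert 0 (Finset.univ.image fun i => Finsupp.single i 1)
  have hS : P.support ⊆ S := by
    intro d hd
    rcases key d hd with rfl | ⟨i, rfl⟩ <;> simp [S]
  rw [MvPolynomial.eval_eq, Finset.sum_subset hS]
  · rw [Finset.sum_insert, Finset.sum_image]
    · congr 1
      · simp
      · refine Finset.sum_congr rfl fun i _ => ?_
        congr 1
        simp [Finsupp.support_single]
    · intro i _ j _ h
      exact Finsupp.single_left_injective one_ne_zero h
    · simp
  · intro d _ hd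
    simp [MvPolynomial.notMem_support_iff.mp hd]

lemma mem_reedMuller_one_iff {m : ℕ} {g : (Fin m → F) → F} :
    g ∈ reedMuller F 1 m ↔ ∃ (a : Fin m → F) (c : F), ∀ x, g x = c + a ⬝ᵥ x := by
  constructor
  · rintro ⟨P, -, hP, h⟩
    exact ⟨_, _, fun x => (h x).symm.trans (MvPolynomial.eval_eq_affine_of_totalDegree_le_one hP x)⟩
  · rintro ⟨a, c, h⟩
    let P : MvPolynomial (Fin m) F :=
      MvPolynomial.C c + ∑ i, MvPolynomial.C (a i) * MvPolynomial.X i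
    have hP : P.totalDegree ≤ 1 := by
      refine (MvPolynomial.totalDegree_add _ _).trans (max_le (by simp) ?_)
      refine MvPolynomial.totalDegree_finsetSum_le fun i _ => ?_
      refine (MvPolynomial.totalDegree_mul _ _).trans ?_
      simp
    refine ⟨P, fun i => ?_, hP, fun x => ?_⟩
    -- Total degree at most 1 suffices, because `q - 1 ≥ 1`.
    · have := Fintype.one_lt_card (α := F)
      have := (MvPolynomial.degreeOf_le_totalDegree P i).trans hP
      omega
    · simp [P, h, dotProduct]

lemma reedMuller_one_nonempty (m : ℕ) : (reedMuller F 1 m).Nonempty :=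
  ⟨fun _ => 0, mem_reedMuller_one_iff.mpr ⟨0, 0, by simp⟩⟩

variable [DecidableEq F]

/-- The number of points where `f` agrees with the affine function `x ↦ c + a ⬝ᵥ x`. -/
def agreement {ι : Type*} [Fintype ι] [DecidableEq ι] (f : (ι → F) → F) (a : ι → F) (c : F) : ℕ :=
  (Finset.univ.filter fun x => f x = c + a ⬝ᵥ x).card

lemma exists_add_agreement_eq (m : ℕ) (f : (Fin m → F) → F) :
    ∃ a c, distToCode (reedMuller F 1 m) f + agreement f a c = Fintype.card F ^ m := by
  obtain ⟨g, hg, hd⟩ := exists_mem_hammingDist_eq_distToCode (reedMuller_one_nonempty m) f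
  obtain ⟨a, c, h⟩ := mem_reedMuller_one_iff.mp hg
  obtain rfl : g = _ := funext h
  refine ⟨a, c, ?_⟩
  rw [← hd, agreement, hammingDist_add_card_agree]
  simp

lemma distToCode_add_agreement_le (m : ℕ) (f : (Fin m → F) → F) (a : Fin m → F) (c : F) :
    distToCode (reedMuller F 1 m) f + agreement f a c ≤ Fintype.card F ^ m := by
  have h := hammingDist_add_card_agree f (fun x => c + a ⬝ᵥ x)
  rw [show Fintype.card (Fin m → F) = Fintype.card F ^ m by simp] at h
  rw [← h]
  exact Nat.add_le_add_right (distToCode_le (mem_reedMuller_one_iff.mpr ⟨a, c, fun _ => rfl⟩)) _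

end AffineFunctions

/-! ### Lower bound: quadratic forms. -/

section LowerBound

variable {F : Type*} [Field F] [Fintype F] [DecidableEq F]

/-- Adding a hyperbolic plane to a function. -/
def addHyperbolic {m : ℕ} (f : (Fin m → F) → F) (z : Fin (m + 2) → F) : F :=
  z 0 * z 1 + f fun i => z i.succ.succ

/-- Each `x ≠ u` admits at most one `y`; the line `x = u` contributes only when `t = 0`, and then
fully. -/
lemma sum_hyperbola_le (u v t : F) :
    ∑ x : F, ∑ y : F, (if (x - u) * (y - v) = t then 1 else 0) ≤
      (Fintype.card F - 1) + Fintype.card F * if t = 0 then 1 else 0 := by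
  rw [← Finset.add_sum_erase _ _ (Finset.mem_univ u), add_comm]
  refine add_le_add ?_ ?_
  · refine (Finset.sum_le_card_nsmul _ _ 1 fun x hx => ?_).trans ?_
    · have hxu : x - u ≠ 0 := sub_ne_zero.mpr (Finset.ne_of_mem_erase hx)
      rw [← Finset.card_filter, Finset.card_le_one]
      intro y hy z hz
      simp only [Finset.mem_filter, Finset.mem_univ, true_and] at hy hz
      exact sub_left_injective (mul_left_cancel₀ hxu (hy.trans hz.symm))
    · simp [Finset.card_erase_of_mem]
  · simp [eq_comm]

/-- Completing the product over each `w` gives a hyperbola centred at `(a 1, a 0)`. It degenerates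
exactly where `f` meets the affine function with constant `c + a 0 * a 1`. -/
lemma agreement_addHyperbolic_le {m : ℕ} (f : (Fin m → F) → F) (a : Fin (m + 2) → F) (c : F) :
    agreement (addHyperbolic f) a c ≤ (Fintype.card F - 1) * Fintype.card F ^ m +
      Fintype.card F * agreement f (fun i => a i.succ.succ) (c + a 0 * a 1) := by
  have hsum : agreement (addHyperbolic f) a c = ∑ w : Fin m → F, ∑ x : F, ∑ y : F,
      if (x - a 1) * (y - a 0) = c + a 0 * a 1 + (fun i => a i.succ.succ) ⬝ᵥ w - f w
        then 1 else 0 := by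
    rw [agreement, Finset.card_filter, ← (Fin.consEquiv fun _ => F).sum_comp,
      Fintype.sum_prod_type]
    simp_rw [← (Fin.consEquiv fun _ : Fin (m + 1) => F).sum_comp, Fintype.sum_prod_type]
    rw [Finset.sum_comm (s := (Finset.univ : Finset (Fin m → F)))]
    refine Finset.sum_congr rfl fun x _ => ?_
    rw [Finset.sum_comm]
    refine Finset.sum_congr rfl fun w _ => Finset.sum_congr rfl fun y _ => if_congr ?_ rfl rfl
    simp only [addHyperbolic, Fin.consEquiv_apply, dotProduct, Fin.sum_univ_succ (n := m + 1),
      Fin.sum_univ_succ (n := m), Fin.cons_zero, Fin.cons_succ, Fin.cons_one, Fin.succ_zero_eq_one]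
    constructor <;> intro h <;> linear_combination h
  rw [hsum]
  refine (Finset.sum_le_sum fun w _ => sum_hyperbola_le _ _ _).trans ?_
  rw [Finset.sum_add_distrib, ← Finset.mul_sum, agreement, Finset.card_filter]
  refine add_le_add (by simp [mul_comm]) (Nat.mul_le_mul_left _ (Finset.sum_le_sum fun w _ => ?_))
  simp only [sub_eq_zero]
  exact le_of_eq (if_congr eq_comm rfl rfl)

lemma exists_agreement_fin_one_le : ∃ f : (Fin 1 → F) → F, ∀ a c, agreement f a c ≤ 2 := by
  refine ⟨fun x => x 0 ^ 2, fun a c => ?_⟩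
  let p : Polynomial F := Polynomial.C 1 * Polynomial.X ^ 2 + Polynomial.C (-a 0) * Polynomial.X
    + Polynomial.C (-c)
  have hp : p.natDegree = 2 := Polynomial.natDegree_quadratic one_ne_zero
  have hp0 : p ≠ 0 := by rintro h; simp [h] at hp
  rw [agreement, ← Finset.card_image_of_injective (f := fun x : Fin 1 → F => x 0) _
    (fun x y h => funext fun i => by rwa [Subsingleton.elim i 0])]
  refine le_trans ?_ hp.le
  refine Polynomial.card_le_degree_of_subset_roots fun y hy => ?_
  obtain ⟨x, hx, rfl⟩ := Finset.mem_image.mp hy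
  simp only [Finset.mem_filter, Finset.mem_univ, true_and, dotProduct, Fin.sum_univ_one] at hx
  rw [Polynomial.mem_roots hp0, Polynomial.IsRoot]
  simp only [p, Polynomial.eval_add, Polynomial.eval_mul, Polynomial.eval_pow,
    Polynomial.eval_X, Polynomial.eval_C]
  linear_combination hx

/-- With `F ^ 2` identified with the quadratic extension, nondegeneracy of the trace form writes any
linear form as `Tr (α y)`. Agreement with the norm `y ^ (q + 1)` then makes `y` a root of a
polynomial of degree `q + 1`. -/
lemma exists_agreement_fin_two_le :
    ∃ f : (Fin 2 → F) → F, ∀ a c, agreement f a c ≤ Fintype.card F + 1 := by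
  obtain ⟨p, hchar⟩ := CharP.exists F
  have : Fact p.Prime := ⟨CharP.char_is_prime F p⟩
  let K := FiniteField.Extension F p 2
  have hK : Module.finrank F K = 2 := FiniteField.finrank_extension F p 2
  let e : (Fin 2 → F) ≃ₗ[F] K := LinearEquiv.ofFinrankEq _ _ (by simp [hK])
  have hq : 1 < Fintype.card F := Fintype.one_lt_card
  refine ⟨fun x => Algebra.norm F (e x), fun a c => ?_⟩
  let φ : Module.Dual F K := (dotProductBilin F F a).comp e.symm.toLinearMap
  obtain ⟨α, hα⟩ := ((Algebra.traceForm F K).toDual (traceForm_nondegenerate F K)).surjective φ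
  have htr : ∀ x, Algebra.trace F K (α * e x) = a ⬝ᵥ x := by
    intro x
    have := congrArg (fun ψ => ψ (e x)) hα
    simpa [φ, LinearMap.BilinForm.toDual_def] using this
  set q := Fintype.card F with hqdef
  let r : Polynomial K := Polynomial.C (-algebraMap F K c) + Polynomial.C (-α) * Polynomial.X
    + Polynomial.C (-α ^ q) * Polynomial.X ^ q
  have hr : r.natDegree < q + 1 := by
    have : r.natDegree ≤ q := by
      simp only [r]
      compute_degree
      omega
    omega
  let P : Polynomial K := Polynomial.X ^ (q + 1) + r
  have hP : P.natDegree = q + 1 := by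
    simp only [P]
    rw [Polynomial.natDegree_add_eq_left_of_natDegree_lt] <;> simp [hr]
  have hP0 : P ≠ 0 := by rintro h; simp [h] at hP
  classical
  rw [agreement, ← Finset.card_image_of_injective _ e.injective, ← hP]
  refine Polynomial.card_le_degree_of_subset_roots fun y hy => ?_
  obtain ⟨x, hx, rfl⟩ := Finset.mem_image.mp hy
  simp only [Finset.mem_filter, Finset.mem_univ, true_and] at hx
  rw [← htr] at hx
  have hx := congrArg (algebraMap F K) hx
  rw [map_add, FiniteField.algebraMap_trace_eq_sum_pow, FiniteField.algebraMap_norm_eq_prod_pow,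
    hK] at hx
  simp only [Finset.sum_range_succ, Finset.prod_range_succ, Finset.range_zero, Finset.prod_empty,
    Finset.sum_empty, Nat.card_eq_fintype_card, ← hqdef] at hx
  rw [Polynomial.mem_roots hP0, Polynomial.IsRoot]
  simp only [P, r, Polynomial.eval_add, Polynomial.eval_mul, Polynomial.eval_pow,
    Polynomial.eval_X, Polynomial.eval_C]
  linear_combination hx

lemma exists_agreement_le (m : ℕ) : ∃ f : (Fin (m + 1) → F) → F, ∀ a c,
    agreement f a c ≤ Fintype.card F ^ m + Fintype.card F ^ (m / 2) := by
  induction m using Nat.twoStepInduction with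
  | zero => simpa using exists_agreement_fin_one_le (F := F)
  | one => simpa using exists_agreement_fin_two_le (F := F)
  | more m ih _ =>
    obtain ⟨f, hf⟩ := ih
    refine ⟨addHyperbolic f, fun a c => ?_⟩
    refine (agreement_addHyperbolic_le f a c).trans
      ((Nat.add_le_add_left (Nat.mul_le_mul_left _ (hf _ _)) _).trans (le_of_eq ?_))
    obtain ⟨k, hk⟩ : ∃ k, Fintype.card F = k + 1 := ⟨_, (Nat.succ_pred Fintype.card_ne_zero).symm⟩
    rw [hk, show (m + 2) / 2 = m / 2 + 1 by omega, Nat.add_sub_cancel]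
    ring

end LowerBound

/-! ### Upper bound: second moment of the agreements. -/

section UpperBound

variable {F : Type*} [Field F] [Fintype F] [DecidableEq F]

lemma card_mul_card_filter_dotProduct_eq {ι : Type*} [Fintype ι] [DecidableEq ι] {v : ι → F}
    (hv : v ≠ 0) (t : F) :
    Fintype.card F * (Finset.univ.filter fun a : ι → F => a ⬝ᵥ v = t).card =
      Fintype.card F ^ Fintype.card ι := by
  obtain ⟨i, hi⟩ := Function.ne_iff.mp hv
  have hconst : ∀ s, (Finset.univ.filter fun a : ι → F => a ⬝ᵥ v = s).card =
      (Finset.univ.filter fun a : ι → F => a ⬝ᵥ v = t).card := by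
    intro s
    -- Translation by `b` carries the fibre over `s` to the fibre over `t`.
    let b : ι → F := Pi.single i ((t - s) / v i)
    have hb : b ⬝ᵥ v = t - s := by
      rw [single_dotProduct, div_mul_cancel₀ _ hi]
    refine Finset.card_equiv (Equiv.addRight b) fun a => ?_
    simp only [Finset.mem_filter, Finset.mem_univ, true_and, Equiv.coe_addRight, add_dotProduct, hb]
    constructor <;> intro h <;> linear_combination h
  have h := Finset.card_eq_sum_card_fiberwise (s := (Finset.univ : Finset (ι → F)))
    (t := Finset.univ) (f := fun a => a ⬝ᵥ v) (by simp)
  simp only [hconst] at h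
  simpa using h.symm

lemma sum_agreement {m : ℕ} (f : (Fin m → F) → F) (a : Fin m → F) :
    ∑ c, agreement f a c = Fintype.card F ^ m := by
  have h := Finset.card_eq_sum_card_fiberwise (s := (Finset.univ : Finset (Fin m → F)))
    (t := Finset.univ) (f := fun x => f x - a ⬝ᵥ x) (by simp)
  simp only [Finset.card_univ, Fintype.card_fun, Fintype.card_fin] at h
  simp only [agreement, h, sub_eq_iff_eq_add]

/-- A square counts pairs of agreement points, and `x` alone determines `c`. -/
lemma sum_agreement_sq_eq {m : ℕ} (f : (Fin m → F) → F) (a : Fin m → F) :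
    ∑ c, agreement f a c ^ 2 =
      ∑ x, ∑ y, if a ⬝ᵥ (x - y) = f x - f y then 1 else 0 := by
  simp_rw [agreement, Finset.card_filter, sq, Finset.sum_mul_sum]
  rw [Finset.sum_comm]
  refine Finset.sum_congr rfl fun x _ => ?_
  rw [Finset.sum_comm]
  refine Finset.sum_congr rfl fun y _ => ?_
  rw [Finset.sum_eq_single (f x - a ⬝ᵥ x)]
  · simp only [sub_add_cancel, if_true, one_mul, dotProduct_sub]
    refine if_congr ?_ rfl rfl
    constructor <;> intro h <;> linear_combination h
  · intro c _ hc
    rw [if_neg, zero_mul]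
    exact fun h => hc (eq_sub_of_add_eq h.symm)
  · simp

/-- For `x ≠ y` the condition on `a` is one nontrivial linear equation, whose number of solutions
does not depend on `f`; for `x = y` it is vacuous. -/
lemma sum_sum_agreement_sq {m : ℕ} (f : (Fin m → F) → F) :
    Fintype.card F * ∑ a, ∑ c, agreement f a c ^ 2 =
      Fintype.card F ^ m * Fintype.card F ^ m * (Fintype.card F + Fintype.card F ^ m - 1) := by
  simp_rw [sum_agreement_sq_eq]
  rw [Finset.sum_comm]
  have key : ∀ x y : Fin m → F,
      Fintype.card F * ∑ a : Fin m → F, (if a ⬝ᵥ (x - y) = f x - f y then 1 else 0) =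
        if x = y then Fintype.card F * Fintype.card F ^ m else Fintype.card F ^ m := by
    intro x y
    rw [← Finset.card_filter]
    split_ifs with h
    · simp [h]
    · rw [card_mul_card_filter_dotProduct_eq (sub_ne_zero.mpr h), Fintype.card_fin]
  have hrow : ∀ x : Fin m → F, Fintype.card F * ∑ a : Fin m → F,
      ∑ y, (if a ⬝ᵥ (x - y) = f x - f y then 1 else 0) =
        Fintype.card F ^ m * (Fintype.card F + Fintype.card F ^ m - 1) := by
    intro x
    rw [Finset.sum_comm, Finset.mul_sum]
    simp_rw [key]
    rw [← Finset.add_sum_erase _ _ (Finset.mem_univ x), if_pos rfl,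
      Finset.sum_congr rfl fun y hy => if_neg (Finset.ne_of_mem_erase hy).symm]
    simp only [Finset.sum_const, Finset.card_erase_of_mem (Finset.mem_univ x), Finset.card_univ,
      Fintype.card_fun, Fintype.card_fin, smul_eq_mul]
    rw [Nat.add_sub_assoc (Nat.one_le_pow _ _ Fintype.card_pos)]
    ring
  rw [Finset.mul_sum, Finset.sum_congr rfl fun x _ => hrow x]
  simp [mul_assoc]

/-- If real numbers sum to zero and are all at most `M`, then their mean square is at most
`(n - 1) * M ^ 2`, where `n` is their number. -/
lemma sum_sq_le_of_sum_eq_zero {ι : Type*} [Fintype ι] (d : ι → ℝ) (M : ℝ) (h0 : ∑ i, d i = 0)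
    (hM : ∀ i, d i ≤ M) :
    ∑ i, d i ^ 2 ≤ Fintype.card ι * (Fintype.card ι - 1) * M ^ 2 := by
  -- The gaps `M - d i` are nonnegative with sum `n * M`, so cross terms can be dropped.
  have h1 : ∑ i, (M - d i) ^ 2 ≤ (∑ i, (M - d i)) ^ 2 :=
    Finset.sum_sq_le_sq_sum_of_nonneg fun i _ => sub_nonneg.mpr (hM i)
  have h2 : ∑ i, (M - d i) ^ 2 = Fintype.card ι * M ^ 2 + ∑ i, d i ^ 2 := by
    simp_rw [show ∀ i, (M - d i) ^ 2 = M ^ 2 - 2 * M * d i + d i ^ 2 from fun i => by ring]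
    rw [Finset.sum_add_distrib, Finset.sum_sub_distrib, ← Finset.mul_sum, h0]
    simp
  rw [h2, Finset.sum_sub_distrib, h0] at h1
  simp only [Finset.sum_const, Finset.card_univ, nsmul_eq_mul, sub_zero] at h1
  linarith

lemma pow_le_sq_of_agreement_le {m : ℕ} (f : (Fin (m + 1) → F) → F) (M : ℝ)
    (hM : ∀ a c, (agreement f a c : ℝ) ≤ (Fintype.card F : ℝ) ^ m + M) :
    0 ≤ M ∧ (Fintype.card F : ℝ) ^ m ≤ Fintype.card F * M ^ 2 := by
  have hq1 : (1 : ℝ) < Fintype.card F := by exact_mod_cast Fintype.one_lt_card (α := F)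
  have hS1 : ∀ a, ∑ c, (agreement f a c : ℝ) = (Fintype.card F : ℝ) ^ (m + 1) := fun a => by
    exact_mod_cast sum_agreement f a
  have hS2 : (Fintype.card F : ℝ) * ∑ a, ∑ c, (agreement f a c : ℝ) ^ 2 =
      (Fintype.card F : ℝ) ^ (m + 1) * (Fintype.card F : ℝ) ^ (m + 1) *
        (Fintype.card F + (Fintype.card F : ℝ) ^ (m + 1) - 1) := by
    have h := sum_sum_agreement_sq f
    rw [← Nat.cast_inj (R := ℝ), Nat.cast_mul, Nat.cast_mul,
      Nat.cast_sub (le_add_right (Nat.succ_le_of_lt Fintype.card_pos))] at h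
    push_cast at h
    exact h
  set q : ℝ := (Fintype.card F : ℝ) with hq
  have h0 : ∀ a, ∑ c, ((agreement f a c : ℝ) - q ^ m) = 0 := fun a => by
    rw [Finset.sum_sub_distrib, hS1]
    simp only [Finset.sum_const, Finset.card_univ, nsmul_eq_mul, ← hq]
    ring
  have hle : ∀ a c, (agreement f a c : ℝ) - q ^ m ≤ M := fun a c => by linarith [hM a c]
  have hvar : ∀ a, ∑ c, ((agreement f a c : ℝ) - q ^ m) ^ 2 =
      ∑ c, (agreement f a c : ℝ) ^ 2 - q ^ m * q ^ (m + 1) := fun a => by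
    -- The last term is split off because it sums to zero over `c`.
    simp_rw [show ∀ c, ((agreement f a c : ℝ) - q ^ m) ^ 2 =
      (agreement f a c : ℝ) ^ 2 - q ^ m * agreement f a c
        - q ^ m * ((agreement f a c : ℝ) - q ^ m) from fun c => by ring]
    rw [Finset.sum_sub_distrib, Finset.sum_sub_distrib, ← Finset.mul_sum, ← Finset.mul_sum, h0,
      hS1, mul_zero, sub_zero]
  constructor
  · by_contra! hneg
    have := Finset.sum_lt_sum_of_nonempty (s := (Finset.univ : Finset F)) Finset.univ_nonempty
      fun c _ => (hle 0 c).trans_lt hneg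
    rw [h0] at this
    simp at this
  · have hsum := Finset.sum_le_sum fun a (_ : a ∈ Finset.univ) =>
      sum_sq_le_of_sum_eq_zero _ M (h0 a) (hle a)
    simp_rw [hvar] at hsum
    rw [Finset.sum_sub_distrib] at hsum
    simp only [Finset.sum_const, Finset.card_univ, nsmul_eq_mul, ← hq, Fintype.card_fun,
      Fintype.card_fin, Nat.cast_pow] at hsum
    have hqm : 0 < q ^ (m + 1) := by positivity
    have h3 : q ^ (m + 1) * (q - 1) * (q ^ (m + 1)) ≤ q ^ (m + 1) * (q - 1) * (q * (q * M ^ 2)) := by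
      have := mul_le_mul_of_nonneg_left hsum (by positivity : 0 ≤ q)
      rw [mul_sub, hS2] at this
      refine le_trans (le_of_eq ?_) (this.trans (le_of_eq ?_)) <;> ring
    have h4 := le_of_mul_le_mul_left h3 (mul_pos hqm (sub_pos.mpr hq1))
    rw [pow_succ, mul_comm] at h4
    exact le_of_mul_le_mul_left h4 (by positivity)

end UpperBound

theorem theorem1p3 {F : Type*} [Field F] [Fintype F] [DecidableEq F] (q : ℕ)
    (hq : Fintype.card F = q) (m : ℕ) (hm : 1 ≤ m) :
    ((q : ℝ) - 1) * (q : ℝ) ^ ((m : ℤ) - 1) - (q : ℝ) ^ (⌈(m : ℝ) / 2⌉ - 1 : ℤ)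
        ≤ (coveringRadius (reedMuller F 1 m) : ℝ) ∧
      (coveringRadius (reedMuller F 1 m) : ℝ)
        ≤ ((q : ℝ) - 1) * (q : ℝ) ^ ((m : ℤ) - 1) - (q : ℝ) ^ ((m : ℝ) / 2 - 1) := by
  obtain ⟨n, rfl⟩ : ∃ n, m = n + 1 := ⟨m - 1, by omega⟩
  have hq0 : (0 : ℝ) < q := by
    rw [← hq]
    exact_mod_cast Fintype.card_pos (α := F)
  have hceil : ⌈((n + 1 : ℕ) : ℝ) / 2⌉ - 1 = ((n / 2 : ℕ) : ℤ) := by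
    rw [sub_eq_iff_eq_add, Int.ceil_eq_iff]
    rcases Nat.even_or_odd' n with ⟨k, rfl | rfl⟩
    · rw [Nat.mul_div_cancel_left k two_pos]
      push_cast
      constructor <;> linarith
    · rw [show (2 * k + 1) / 2 = k by omega]
      push_cast
      constructor <;> linarith
  rw [hceil, show ((n + 1 : ℕ) : ℤ) - 1 = (n : ℕ) by push_cast; ring, zpow_natCast, zpow_natCast]
  constructor
  · obtain ⟨f, hf⟩ := exists_agreement_le (F := F) n
    obtain ⟨a, c, hac⟩ := exists_add_agreement_eq (n + 1) f
    have h1 := hf a c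
    have h2 := distToCode_le_coveringRadius (reedMuller_one_nonempty (n + 1)) f
    rw [hq] at h1 hac
    rw [← Nat.cast_le (α := ℝ)] at h1 h2
    rw [← Nat.cast_inj (R := ℝ)] at hac
    push_cast at h1 hac
    linarith [pow_succ (q : ℝ) n]
  · obtain ⟨f, hf⟩ := exists_distToCode_eq_coveringRadius (reedMuller_one_nonempty (F := F) (n + 1))
    -- For an `f` attaining the covering radius, `M` is the excess of the maximal agreement over the
    -- mean `q ^ n`; `0 ≤ M` later permits taking square roots.
    obtain ⟨hM0, hM⟩ := pow_le_sq_of_agreement_le f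
      ((q : ℝ) ^ (n + 1) - q ^ n - coveringRadius (reedMuller F 1 (n + 1))) fun a c => by
        have h := distToCode_add_agreement_le (n + 1) f a c
        rw [hq, hf, ← Nat.cast_le (α := ℝ)] at h
        push_cast at h
        rw [hq]
        linarith
    rw [hq] at hM
    have hsq : ((q : ℝ) ^ (((n + 1 : ℕ) : ℝ) / 2 - 1)) ^ 2 * q = q ^ n := by
      rw [← Real.rpow_natCast, ← Real.rpow_mul hq0.le, ← Real.rpow_add_one hq0.ne',
        ← Real.rpow_natCast]
      congr 1
      push_cast
      ring
    have := (sq_le_sq₀ (by positivity) hM0).mp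
      (le_of_mul_le_mul_left (((mul_comm _ _).trans hsq).trans_le hM) hq0)
    linarith [pow_succ (q : ℝ) n]
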